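/- Let \(K\) be a field of characteristic different from \(2\). For \(m\ge 0\) let \(\zeta_{2^m}\) be a root of unity of order \(2^m\) in a fixed algebraic closure of \(K\), and put \(K_{2^m}:=K(\zeta_{2^m})\) and \(K_{2^\infty}:=\bigcup_{m\ge 1}K_{2^m}\). For \(a\in K^\times\) and \(m\ge n>0\), \(K_{2^m}(\sqrt[2^n]{a})\) is the extension of \(K_{2^m}\) obtained by adjoining one (equivalently, all) of the \(2^n\)-th roots of \(a\). An element \(b\in K^\times\) is called strongly indivisible if, for every root of unity \(\xi\in K\) whose order is a power of \(2\), \(b\xi\) is not a square in \(K\). Theorem. Suppose that \(\zeta_4\notin K\), let \(a\in K^\times\) and let \(m\ge n>0\) be integers. If \(K_4\ne K_{2^\infty}\), there is a greatest integer \(s\) such that \(K_4=K_{2^s}\); in this case let \(s\) denote this integer. 1. If \(a=b^{2^d}\) for some \(d\ge 0\) and some strongly indivisible \(b\in K^\times\), then \[[K_{2^m}(\sqrt[2^n]{a}):K_{2^m}]=2^{\max(0,\,n-d)},\] unless \(K_4\ne K_{2^\infty}\), \(K(\sqrt b)\subseteq K_{2^\infty}\) and \(m\ge s+1\) all hold,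 in which case \[[K_{2^m}(\sqrt[2^n]{a}):K_{2^m}]=2^{\max(0,\,n-d-1)}.\] 2. If \(a=-b^{2^d}\) for some \(d>0\) and some strongly indivisible \(b\in K^\times\), then \[[K_{2^m}(\sqrt[2^n]{a}):K_{2^m}]=[K_{2^m}(\sqrt[2^n]{-a}):K_{2^m}],\] with exactly the following exceptions: - If \(m=n=1\), then \([K(\sqrt{-a}):K]=1\) and \([K(\sqrt{a}):K]=2\). - If \(K_4\ne K_{2^\infty}\), \(m=n\ge s\) and \([K_{2^m}(\sqrt[2^n]{-a}):K_{2^m}]=1\), then \([K_{2^m}(\sqrt[2^n]{a}):K_{2^m}]=2\). - If \(K_4\ne K_{2^\infty}\), \(K(\sqrt b)\subseteq K_{2^\infty}\), \(m=n=s=d+1\) and \([K_{2^m}(\sqrt[2^n]{-a}):K_{2^m}]=2\), then \([K_{2^m}(\sqrt[2^n]{a}):K_{2^m}]=1\). -/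

import Mathlib

/-- The field `K_{ℓ^m} = K(ζ_{ℓ^m})` inside the algebraic closure of `K`: the roots of unity of
exact order `ℓ^m` are adjoined (they are powers of one another, so adjoining one of them is the
same as adjoining all of them). -/
noncomputable def cycField (K : Type*) [Field K] (ℓ m : ℕ) :
    IntermediateField K (AlgebraicClosure K) :=
  IntermediateField.adjoin K {z : AlgebraicClosure K | IsPrimitiveRoot z (ℓ ^ m)}

/-- The field `K_{ℓ^∞}`, the union of the fields `K_{ℓ^m}` (an increasing chain) for `m ≥ 1`. -/
noncomputable def cycTower (K : Type*) [Field K] (ℓ : ℕ) :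
    IntermediateField K (AlgebraicClosure K) :=
  ⨆ (m : ℕ) (_ : 1 ≤ m), cycField K ℓ m

/-- The field `F(\sqrt[N]{a})` for `a ∈ K` and a field `F` between `K` and its algebraic closure,
obtained by adjoining to `F` all `N`-th roots of `a`. It is an extension of `F`. -/
noncomputable def radicalField {K : Type*} [Field K]
    (F : IntermediateField K (AlgebraicClosure K)) (N : ℕ) (a : K) :
    IntermediateField F (AlgebraicClosure K) :=
  IntermediateField.adjoin F
    {x : AlgebraicClosure K | x ^ N = algebraMap K (AlgebraicClosure K) a}

/-- The field `K(\sqrt{b})`, as an extension of `K`. -/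
noncomputable def sqrtField {K : Type*} [Field K] (b : K) :
    IntermediateField K (AlgebraicClosure K) :=
  IntermediateField.adjoin K
    {x : AlgebraicClosure K | x ^ 2 = algebraMap K (AlgebraicClosure K) b}

/-- The degree `[K_{ℓ^m}(\sqrt[ℓ^n]{a}) : K_{ℓ^m}]`. -/
noncomputable def kummerDegree {K : Type*} [Field K] (ℓ m n : ℕ) (a : K) : ℕ :=
  Module.finrank (cycField K ℓ m) (radicalField (cycField K ℓ m) (ℓ ^ n) a)

/-- `a` is strongly indivisible (with respect to `ℓ`): for every root of unity `ξ ∈ K` whose order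
is a power of `ℓ`, the element `a * ξ` has no `ℓ`-th root in `K`. -/
def StronglyIndivisible {K : Type*} [Field K] (ℓ : ℕ) (a : K) : Prop :=
  ∀ ξ : K, (∃ k : ℕ, ξ ^ ℓ ^ k = 1) → ¬ ∃ y : K, y ^ ℓ = a * ξ

/-! Write F_m for `cycField K 2 m`, ζ_m for `twoPowRoot K m`, i = ζ_2 and c for a square root of b.
Since n ≤ m, F_m contains the 2^n-th roots of unity, so a single root x of X^(2^n) - a generates the
radical extension. If x^(2^k) is a nonsquare of F_m, and k = 1 or i ∈ F_m, the degree is 2^k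
(`kummerDegree_two_eq`). Every degree thus reduces to deciding whether some element of F_m is a
square there.

For b^(2^d) with d < n, choose x with x^(2^(n-d)) = b. If c ∉ F_m, b is a nonsquare and the degree
is 2^(n-d). If c ∈ F_m, then c is a nonsquare, because a fourth root of b would contradict the
commutativity of automorphisms on F_m (`StronglyIndivisible.sq_sq_ne_of_mem_cycField`). To locate c:
strong indivisibility keeps it out of F_2 = F_s, the tower grows strictly from level s on, and any
square root of an element of K inside the tower already lies in F_{s+1}
(`mem_cycField_of_sq_mem_range`).

Passing to -b^(2^d) multiplies x by ζ_{n+1}, which is harmless for n < m. Let m = n. If x ∈ F_n, all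
depends on whether ζ_{n+1} ∈ F_n. Otherwise -b^(2^d) = (b ζ_{d+1})^(2^d) replaces b by b ζ_{d+1},
and c by c ζ_{d+2} when c ∈ F_n. The latter remains a nonsquare
(`StronglyIndivisible.sq_ne_mul_twoPowRoot`); the former can become a square only for n = d + 1 = s,
which is the last exception. -/

open Polynomial IntermediateField

/-! ### Binomials X^(2^k) - a -/

/-- Over a field containing a square root of `-1`, the polynomial `X ^ 2 ^ k - a` is irreducible
as soon as `a` is not a square. -/
theorem irreducible_X_pow_two_pow_sub_C {F : Type*} [Field F] {i a : F} (hi : i ^ 2 = -1)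
    (ha : ∀ y : F, y ^ 2 ≠ a) (k : ℕ) : Irreducible (X ^ 2 ^ k - C a) := by
  induction k generalizing F with
  | zero => simpa using irreducible_X_sub_C a
  | succ k ih =>
    rw [pow_succ]
    apply X_pow_mul_sub_C_irreducible (X_pow_sub_C_irreducible_of_prime Nat.prime_two ha)
    intro E _ _ x hx
    have hint : IsIntegral F x := not_not.mp fun h ↦ by
      simpa only [degree_zero, degree_X_pow_sub_C two_pos, WithBot.natCast_ne_bot]
        using congr_arg degree (hx.symm.trans (dif_neg h))
    refine ih (i := algebraMap F _ i) (by rw [← map_pow, hi]; simp) fun y hy ↦ ?_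
    -- If y^2 = x in F(x), then N(y)^2 = N(x) = -a, so i N(y) is a square root of a in F.
    apply ha (i * Algebra.norm F y)
    rw [mul_pow, hi, ← map_pow, hy, ← adjoin.powerBasis_gen hint,
      Algebra.PowerBasis.norm_gen_eq_coeff_zero_minpoly]
    simp [minpoly_gen, hx]

/-- The degree of a simple extension generated by a `2 ^ k`-th root of a nonsquare. -/
theorem finrank_adjoin_simple_two_pow_root {F E : Type*} [Field F] [Field E] [Algebra F E]
    {c : F} {x : E} {k : ℕ} (hx : x ^ 2 ^ k = algebraMap F E c)
    (h : k = 0 ∨ (k = 1 ∨ ∃ i : F, i ^ 2 = -1) ∧ ∀ y : F, y ^ 2 ≠ c) :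
    Module.finrank F F⟮x⟯ = 2 ^ k := by
  have hirr : Irreducible (X ^ 2 ^ k - C c) := by
    rcases h with rfl | ⟨rfl | ⟨i, hi⟩, hc⟩
    · simpa using irreducible_X_sub_C c
    · simpa using X_pow_sub_C_irreducible_of_prime Nat.prime_two hc
    · exact irreducible_X_pow_two_pow_sub_C hi hc k
  have hmon : (X ^ 2 ^ k - C c).Monic := monic_X_pow_sub_C c (by positivity)
  have hroot : aeval x (X ^ 2 ^ k - C c) = 0 := by simp [hx]
  rw [adjoin.finrank ⟨_, hmon, hroot⟩, ← minpoly.eq_of_irreducible_of_monic hirr hroot hmon,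
    natDegree_X_pow_sub_C]

/-! ### Quadratic extensions and sign-changing automorphisms -/

section Quadratic

variable {K E : Type*} [Field K] [Field E] [Algebra K E]

/-- If `x` generates `K⟮x⟯` and `x ^ 2` lies in `F`, then `K⟮x⟯ ⊆ F + F x`. -/
theorem exists_add_mul_of_mem_adjoin_simple [Algebra.IsAlgebraic K E] {F : IntermediateField K E}
    {x c : E} (hx : x ^ 2 ∈ F) (hc : c ∈ K⟮x⟯) : ∃ u ∈ F, ∃ v ∈ F, c = u + v * x := by
  have hc' : c ∈ Algebra.adjoin K {x} := by
    rwa [← adjoin_simple_toSubalgebra_of_isAlgebraic (Algebra.IsAlgebraic.isAlgebraic x)]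
  induction hc' using Algebra.adjoin_induction with
  | mem y hy =>
    rw [Set.mem_singleton_iff] at hy
    exact ⟨0, zero_mem _, 1, one_mem _, by rw [hy]; ring⟩
  | algebraMap r => exact ⟨_, F.algebraMap_mem r, 0, zero_mem _, by ring⟩
  | add y z hy hz ihy ihz =>
    have hle := algebra_adjoin_le_adjoin K {x}
    obtain ⟨u, hu, v, hv, rfl⟩ := ihy (hle hy)
    obtain ⟨u', hu', v', hv', rfl⟩ := ihz (hle hz)
    exact ⟨_, add_mem hu hu', _, add_mem hv hv', by ring⟩
  | mul y z hy hz ihy ihz =>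
    have hle := algebra_adjoin_le_adjoin K {x}
    obtain ⟨u, hu, v, hv, rfl⟩ := ihy (hle hy)
    obtain ⟨u', hu', v', hv', rfl⟩ := ihz (hle hz)
    exact ⟨u * u' + v * v' * x ^ 2, add_mem (mul_mem hu hu') (mul_mem (mul_mem hv hv') hx),
      u * v' + v * u', add_mem (mul_mem hu hv') (mul_mem hv hu'), by ring⟩

/-- An element of a quadratic extension `F(x)`, `x ^ 2 ∈ F`, whose square lies in `F` is in `F`
or in `F x`. -/
theorem mem_or_eq_mul_of_sq_mem [Algebra.IsAlgebraic K E] (h2E : (2 : E) ≠ 0)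
    {F : IntermediateField K E} {x c : E} (hx : x ^ 2 ∈ F) (hxF : x ∉ F) (hc : c ∈ K⟮x⟯)
    (hcF : c ^ 2 ∈ F) : c ∈ F ∨ ∃ v ∈ F, c = v * x := by
  obtain ⟨u, hu, v, hv, rfl⟩ := exists_add_mul_of_mem_adjoin_simple hx hc
  have h2F : (2 : E) ∈ F := ofNat_mem F 2
  by_cases hu0 : u = 0
  · exact .inr ⟨v, hv, by simp [hu0]⟩
  by_cases hv0 : v = 0
  · exact .inl (by simpa [hv0] using hu)
  refine (hxF ?_).elim
  have hmem : (2 * u * v) * x ∈ F := by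
    have : (2 * u * v) * x = (u + v * x) ^ 2 - u ^ 2 - v ^ 2 * x ^ 2 := by ring
    rw [this]
    exact sub_mem (sub_mem hcF (pow_mem hu 2)) (mul_mem (pow_mem hv 2) hx)
  have := mul_mem (inv_mem (mul_mem (mul_mem h2F hu) hv)) hmem
  rwa [inv_mul_cancel_left₀ (mul_ne_zero (mul_ne_zero h2E hu0) hv0)] at this

/-- If `c ^ 2 ∈ F` but `c ∉ F`, some automorphism of `E` fixes `F` and changes the sign of `c`. -/
theorem exists_algEquiv_neg [Normal K E] {F : IntermediateField K E} {c : E}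
    (hc2 : c ^ 2 ∈ F) (hc : c ∉ F) : ∃ τ : E ≃ₐ[K] E, (∀ x ∈ F, τ x = x) ∧ τ c = -c := by
  have hirr : Irreducible (X ^ 2 - C (⟨c ^ 2, hc2⟩ : F)) := by
    refine X_pow_sub_C_irreducible_of_prime Nat.prime_two fun y hy ↦ hc ?_
    have hy' : (y : E) ^ 2 = c ^ 2 := congrArg Subtype.val hy
    rcases sq_eq_sq_iff_eq_or_eq_neg.1 hy' with h | h
    · exact h ▸ y.2
    · rw [← neg_neg c, ← h]
      exact neg_mem y.2
  have hmon : (X ^ 2 - C (⟨c ^ 2, hc2⟩ : F)).Monic := monic_X_pow_sub_C _ two_ne_zero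
  have hroot : aeval c (X ^ 2 - C (⟨c ^ 2, hc2⟩ : F)) = 0 := by
    simp [IntermediateField.algebraMap_apply]
  have hmin := minpoly.eq_of_irreducible_of_monic hirr hroot hmon
  have : Normal F E := Normal.tower_top_of_normal K F E
  obtain ⟨τ, hτ⟩ := minpoly.exists_algEquiv_of_root' (K := F) (x := -c) (y := c)
    ⟨_, hmon.ne_zero, hroot⟩ (by rw [← hmin]; simp [IntermediateField.algebraMap_apply])
  exact ⟨τ.restrictScalars K, fun x hx ↦ τ.commutes ⟨x, hx⟩, hτ⟩

/-- An involution fixing a square root of `-1` does not negate a nonzero square. -/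
theorem eq_zero_of_map_sq_eq_neg (h2 : (2 : E) ≠ 0) {i y : E} (hi : i ^ 2 = -1)
    (τ : E ≃ₐ[K] E) (hτi : τ i = i) (hττ : τ (τ y) = y) (hy : τ (y ^ 2) = -y ^ 2) : y = 0 := by
  have h : τ y ^ 2 = (i * y) ^ 2 := by rw [← map_pow, hy, mul_pow, hi]; ring
  -- Here τ y = ±i y with i fixed by τ, so applying τ again gives y = i^2 y = -y.
  have key : -y = y := by
    rcases sq_eq_sq_iff_eq_or_eq_neg.1 h with h | h
    · have h' := congrArg τ h
      rw [hττ, map_mul, hτi, h] at h'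
      linear_combination -h' - y * hi
    · have h' := congrArg τ h
      rw [hττ, map_neg, map_mul, hτi, h] at h'
      linear_combination -h' - y * hi
  have : 2 * y = 0 := by linear_combination -key
  exact (mul_eq_zero.1 this).resolve_left h2

end Quadratic

/-! ### The 2-power cyclotomic tower -/

/-- A compatible system of roots of unity of `2`-power order: `twoPowRoot K m` has order `2 ^ m`
and is the square of `twoPowRoot K (m + 1)`. -/
noncomputable def twoPowRoot (K : Type*) [Field K] : ℕ → AlgebraicClosure K
  | 0 => 1
  -- The value is prescribed because a chosen square root of 1 could be 1 itself.
  | 1 => -1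
  | m + 2 => (IsAlgClosed.exists_pow_nat_eq (twoPowRoot K (m + 1)) two_pos).choose

section TwoPowRoot

variable {K : Type*} [Field K]

theorem two_ne_zero_algebraicClosure (h2 : (2 : K) ≠ 0) : (2 : AlgebraicClosure K) ≠ 0 := by
  have := (_root_.map_ne_zero (algebraMap K (AlgebraicClosure K))).2 h2
  rwa [map_ofNat] at this

theorem twoPowRoot_succ_sq (m : ℕ) : twoPowRoot K (m + 1) ^ 2 = twoPowRoot K m := by
  cases m with
  | zero => simp [twoPowRoot]
  | succ m => exact (IsAlgClosed.exists_pow_nat_eq (twoPowRoot K (m + 1)) two_pos).choose_spec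

theorem twoPowRoot_add_pow (m k : ℕ) : twoPowRoot K (m + k) ^ 2 ^ k = twoPowRoot K m := by
  induction k with
  | zero => simp
  | succ k ih => rw [pow_succ', pow_mul, ← add_assoc, twoPowRoot_succ_sq, ih]

theorem twoPowRoot_pow_eq_one (m : ℕ) : twoPowRoot K m ^ 2 ^ m = 1 := by
  simpa [twoPowRoot] using twoPowRoot_add_pow (K := K) 0 m

theorem twoPowRoot_succ_pow (m : ℕ) : twoPowRoot K (m + 1) ^ 2 ^ m = -1 := by
  simpa [twoPowRoot, add_comm] using twoPowRoot_add_pow (K := K) 1 m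

theorem twoPowRoot_two_sq : twoPowRoot K 2 ^ 2 = -1 := twoPowRoot_succ_pow 1

theorem twoPowRoot_ne_zero (m : ℕ) : twoPowRoot K m ≠ 0 := fun h ↦ by
  simpa [h] using twoPowRoot_pow_eq_one (K := K) m

theorem isPrimitiveRoot_twoPowRoot (h2 : (2 : K) ≠ 0) (m : ℕ) :
    IsPrimitiveRoot (twoPowRoot K m) (2 ^ m) := by
  cases m with
  | zero => simp [twoPowRoot]
  | succ m =>
    rw [IsPrimitiveRoot.iff_orderOf]
    refine orderOf_eq_prime_pow (fun h ↦ two_ne_zero_algebraicClosure h2 ?_)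
      (twoPowRoot_pow_eq_one _)
    rw [twoPowRoot_succ_pow] at h
    linear_combination -h

theorem cycField_two_eq_adjoin (h2 : (2 : K) ≠ 0) (m : ℕ) :
    cycField K 2 m = K⟮twoPowRoot K m⟯ := by
  apply le_antisymm
  · rw [cycField, adjoin_le_iff]
    intro z hz
    obtain ⟨j, -, rfl⟩ := (isPrimitiveRoot_twoPowRoot h2 m).eq_pow_of_pow_eq_one hz.pow_eq_one
    exact pow_mem (mem_adjoin_simple_self K _) j
  · rw [adjoin_simple_le_iff]
    exact subset_adjoin _ _ (isPrimitiveRoot_twoPowRoot h2 m)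

theorem twoPowRoot_mem_cycField (h2 : (2 : K) ≠ 0) {j m : ℕ} (h : j ≤ m) :
    twoPowRoot K j ∈ cycField K 2 m := by
  obtain ⟨k, rfl⟩ := Nat.exists_eq_add_of_le h
  rw [cycField_two_eq_adjoin h2, ← twoPowRoot_add_pow j k]
  exact pow_mem (mem_adjoin_simple_self K _) _

theorem cycField_le_iff (h2 : (2 : K) ≠ 0) {m : ℕ}
    {F : IntermediateField K (AlgebraicClosure K)} :
    cycField K 2 m ≤ F ↔ twoPowRoot K m ∈ F := by
  rw [cycField_two_eq_adjoin h2, adjoin_simple_le_iff]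

theorem cycField_two_mono (h2 : (2 : K) ≠ 0) : Monotone (cycField K 2) := fun _ _ h ↦
  (cycField_le_iff h2).2 (twoPowRoot_mem_cycField h2 h)

theorem mem_cycField_of_pow_eq_one (h2 : (2 : K) ≠ 0) {m : ℕ} {z : AlgebraicClosure K}
    (hz : z ^ 2 ^ m = 1) : z ∈ cycField K 2 m := by
  obtain ⟨j, -, rfl⟩ := (isPrimitiveRoot_twoPowRoot h2 m).eq_pow_of_pow_eq_one hz
  exact pow_mem (twoPowRoot_mem_cycField h2 le_rfl) j

theorem cycField_one (h2 : (2 : K) ≠ 0) : cycField K 2 1 = ⊥ := by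
  rw [cycField_two_eq_adjoin h2, twoPowRoot, adjoin_simple_eq_bot_iff]
  exact neg_mem (one_mem _)

theorem twoPowRoot_two_notMem (h2 : (2 : K) ≠ 0) (h4 : ¬ ∃ z : K, IsPrimitiveRoot z 4) :
    twoPowRoot K 2 ∉ (⊥ : IntermediateField K (AlgebraicClosure K)) := fun h ↦ by
  obtain ⟨z, hz⟩ := mem_bot.1 h
  refine h4 ⟨z, IsPrimitiveRoot.of_map_of_injective (f := algebraMap K (AlgebraicClosure K)) ?_
    (algebraMap K (AlgebraicClosure K)).injective⟩
  rw [hz]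
  exact isPrimitiveRoot_twoPowRoot h2 2

theorem cycField_le_cycTower {m : ℕ} (hm : 1 ≤ m) : cycField K 2 m ≤ cycTower K 2 :=
  le_iSup₂_of_le m hm le_rfl

theorem mem_cycTower_iff (h2 : (2 : K) ≠ 0) {x : AlgebraicClosure K} :
    x ∈ cycTower K 2 ↔ ∃ m, x ∈ cycField K 2 m := by
  have h : cycTower K 2 = ⨆ m, cycField K 2 m := by
    apply le_antisymm
    · exact iSup₂_le fun m _ ↦ le_iSup (cycField K 2) m
    · exact iSup_le fun m ↦ (cycField_two_mono h2 m.le_succ).trans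
        (cycField_le_cycTower (by omega))
  rw [h, ← SetLike.mem_coe, coe_iSup_of_directed (cycField_two_mono h2).directed_le]
  simp

theorem sqrtField_le_iff {b : K} {c : AlgebraicClosure K} (hc : c ^ 2 = algebraMap K _ b)
    (F : IntermediateField K (AlgebraicClosure K)) : sqrtField b ≤ F ↔ c ∈ F := by
  rw [sqrtField, adjoin_le_iff]
  refine ⟨fun h ↦ h hc, fun h x hx ↦ ?_⟩
  rcases sq_eq_sq_iff_eq_or_eq_neg.1 (hx.trans hc.symm) with rfl | rfl
  exacts [h, neg_mem h]

/-- Once the tower grows at a level `m ≥ 2`, it grows at the next level. -/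
theorem twoPowRoot_succ_succ_notMem (h2 : (2 : K) ≠ 0) {m : ℕ} (hm : 2 ≤ m)
    (h : twoPowRoot K (m + 1) ∉ cycField K 2 m) :
    twoPowRoot K (m + 2) ∉ cycField K 2 (m + 1) := fun hmem ↦ by
  have hsq : twoPowRoot K (m + 1) ^ 2 ∈ cycField K 2 m := by
    rw [twoPowRoot_succ_sq]
    exact twoPowRoot_mem_cycField h2 le_rfl
  obtain ⟨τ, hτ, hτneg⟩ := exists_algEquiv_neg hsq h
  rw [cycField_two_eq_adjoin h2] at hmem
  obtain ⟨u, hu, v, hv, huv⟩ := exists_add_mul_of_mem_adjoin_simple hsq hmem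
  -- On F_{m+1} = F_m + F_m ζ_{m+1}, τ is an involution; it fixes i as m ≥ 2, and would negate the
  -- square ζ_{m+2}^2 = ζ_{m+1}.
  refine twoPowRoot_ne_zero (K := K) (m + 2) (eq_zero_of_map_sq_eq_neg
    (two_ne_zero_algebraicClosure h2) twoPowRoot_two_sq τ
    (hτ _ (twoPowRoot_mem_cycField h2 hm)) ?_ ?_)
  · rw [huv]
    simp [hτ u hu, hτ v hv, hτneg]
  · rw [twoPowRoot_succ_sq, hτneg]

theorem twoPowRoot_succ_notMem_of_le (h2 : (2 : K) ≠ 0) {s n : ℕ} (hs : 2 ≤ s) (hn : s ≤ n)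
    (h : twoPowRoot K (s + 1) ∉ cycField K 2 s) : twoPowRoot K (n + 1) ∉ cycField K 2 n := by
  induction n, hn using Nat.le_induction with
  | base => exact h
  | succ n hn ih => exact twoPowRoot_succ_succ_notMem h2 (hs.trans hn) ih

/-- The quadratic subextensions of `K_{2^∞}` are contained in the second field of the tower
above `K_4`. -/
theorem mem_cycField_of_sq_mem_range (h2 : (2 : K) ≠ 0) {s m : ℕ} (hs : 2 ≤ s)
    (h : twoPowRoot K (s + 1) ∉ cycField K 2 s) {b : K} (hb : b ≠ 0) {c : AlgebraicClosure K}
    (hcb : c ^ 2 = algebraMap K _ b) (hc : c ∈ cycField K 2 m) : c ∈ cycField K 2 (s + 1) := by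
  rcases le_total m (s + 1) with hm | hm
  · exact cycField_two_mono h2 hm hc
  induction m, hm using Nat.le_induction with
  | base => exact hc
  | succ m hm ih =>
    by_contra hcs
    obtain ⟨m, rfl⟩ : ∃ k, m = k + 1 := ⟨m - 1, by omega⟩
    have hsq : ∀ k, twoPowRoot K (k + 1) ^ 2 ∈ cycField K 2 k := fun k ↦ by
      rw [twoPowRoot_succ_sq]
      exact twoPowRoot_mem_cycField h2 le_rfl
    have hnot : ∀ k, s ≤ k → twoPowRoot K (k + 1) ∉ cycField K 2 k := fun k hk ↦
      twoPowRoot_succ_notMem_of_le h2 hs hk h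
    have hbF : ∀ k, c ^ 2 ∈ cycField K 2 k := fun k ↦ hcb ▸ IntermediateField.algebraMap_mem _ b
    rw [cycField_two_eq_adjoin h2] at hc
    rcases mem_or_eq_mul_of_sq_mem (two_ne_zero_algebraicClosure h2) (hsq (m + 1))
      (hnot _ (by omega)) hc (hbF _) with hc | ⟨v, hv, rfl⟩
    · exact hcs (ih hc)
    obtain ⟨τ, hτ, hτneg⟩ := exists_algEquiv_neg (hsq m) (hnot m (by omega))
    rw [cycField_two_eq_adjoin h2] at hv
    obtain ⟨p, hp, q, hq, hpq⟩ := exists_add_mul_of_mem_adjoin_simple (hsq m) hv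
    -- Now b = v^2 ζ_{m+1}. As τ fixes b and negates ζ_{m+1}, it negates v^2, where v ∈ F_{m+1};
    -- this forces v = 0.
    have hτb := hcb ▸ τ.commutes b
    rw [mul_pow, twoPowRoot_succ_sq, map_mul, hτneg] at hτb
    have hv0 : v = 0 := by
      refine eq_zero_of_map_sq_eq_neg (two_ne_zero_algebraicClosure h2) twoPowRoot_two_sq τ
        (hτ _ (twoPowRoot_mem_cycField h2 (by omega))) ?_ ?_
      · rw [hpq]
        simp [hτ p hp, hτ q hq, hτneg]
      · apply mul_right_cancel₀ (twoPowRoot_ne_zero (K := K) (m + 1))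
        linear_combination -hτb
    refine hb ((map_eq_zero (algebraMap K (AlgebraicClosure K))).1 ?_)
    rw [← hcb, hv0]
    ring

end TwoPowRoot

/-! ### Nonsquares arising from strong indivisibility -/

section StronglyIndivisible

variable {K : Type*} [Field K]

theorem StronglyIndivisible.sq_ne_mul {b : K} (hb : StronglyIndivisible 2 b)
    {y ξ : AlgebraicClosure K} (hy : y ∈ (⊥ : IntermediateField K (AlgebraicClosure K)))
    (hξ : ξ ∈ (⊥ : IntermediateField K (AlgebraicClosure K))) {k : ℕ} (hξk : ξ ^ 2 ^ k = 1) :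
    y ^ 2 ≠ algebraMap K _ b * ξ := by
  obtain ⟨y, rfl⟩ := mem_bot.1 hy
  obtain ⟨ξ, rfl⟩ := mem_bot.1 hξ
  intro h
  have hinj := (algebraMap K (AlgebraicClosure K)).injective
  exact hb ξ ⟨k, hinj (by simpa using hξk)⟩ ⟨y, hinj (by simpa using h)⟩

/-- A strongly indivisible element is not a square in `K_4`. -/
theorem StronglyIndivisible.notMem_cycField_two (h2 : (2 : K) ≠ 0)
    (h4 : ¬ ∃ z : K, IsPrimitiveRoot z 4) {b : K} (hb : StronglyIndivisible 2 b)
    {c : AlgebraicClosure K} (hcb : c ^ 2 = algebraMap K _ b) : c ∉ cycField K 2 2 := fun hc ↦ by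
  rw [cycField_two_eq_adjoin h2] at hc
  rcases mem_or_eq_mul_of_sq_mem (F := ⊥) (two_ne_zero_algebraicClosure h2)
    (by rw [twoPowRoot_two_sq]; exact neg_mem (one_mem _)) (twoPowRoot_two_notMem h2 h4) hc
    (hcb ▸ IntermediateField.algebraMap_mem _ b) with hc | ⟨v, hv, rfl⟩
  · exact hb.sq_ne_mul hc (one_mem _) (one_pow (2 ^ 0)) (by rw [hcb, mul_one])
  · refine hb.sq_ne_mul hv (neg_mem (one_mem _)) (k := 1) (by norm_num) ?_
    rw [← hcb, mul_pow, twoPowRoot_two_sq]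
    ring

theorem exists_algEquiv_twoPowRoot_two (h2 : (2 : K) ≠ 0)
    (h4 : ¬ ∃ z : K, IsPrimitiveRoot z 4) :
    ∃ σ : AlgebraicClosure K ≃ₐ[K] AlgebraicClosure K, σ (twoPowRoot K 2) = -twoPowRoot K 2 := by
  obtain ⟨σ, -, hσ⟩ := exists_algEquiv_neg (F := (⊥ : IntermediateField K (AlgebraicClosure K)))
    (by rw [twoPowRoot_two_sq]; exact neg_mem (one_mem _)) (twoPowRoot_two_notMem h2 h4)
  exact ⟨σ, hσ⟩

theorem exists_map_twoPowRoot_eq_pow (h2 : (2 : K) ≠ 0) (m : ℕ)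
    (σ : AlgebraicClosure K ≃ₐ[K] AlgebraicClosure K) :
    ∃ j, σ (twoPowRoot K m) = twoPowRoot K m ^ j := by
  obtain ⟨j, -, hj⟩ := (isPrimitiveRoot_twoPowRoot h2 m).eq_pow_of_pow_eq_one
    (ξ := σ (twoPowRoot K m)) (by rw [← map_pow, twoPowRoot_pow_eq_one, map_one])
  exact ⟨j, hj.symm⟩

/-- Automorphisms commute on cyclotomic fields. -/
theorem map_map_comm_of_mem_cycField (h2 : (2 : K) ≠ 0) {m : ℕ} {e : AlgebraicClosure K}
    (he : e ∈ cycField K 2 m) (σ τ : AlgebraicClosure K ≃ₐ[K] AlgebraicClosure K) :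
    σ (τ e) = τ (σ e) := by
  rw [cycField_two_eq_adjoin h2] at he
  induction he using IntermediateField.adjoin_induction with
  | mem x hx =>
    rw [Set.mem_singleton_iff] at hx
    obtain ⟨j, hj⟩ := exists_map_twoPowRoot_eq_pow h2 m σ
    obtain ⟨l, hl⟩ := exists_map_twoPowRoot_eq_pow h2 m τ
    rw [hx, hl, map_pow, hj, map_pow, hl, ← pow_mul, ← pow_mul, mul_comm]
  | algebraMap x => simp
  | add x y _ _ hx hy => simp [hx, hy]
  | inv x _ hx => simp [hx]
  | mul x y _ _ hx hy => simp [hx, hy]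

/-- A strongly indivisible element is not a fourth power in any `K_{2^m}`. -/
theorem StronglyIndivisible.sq_sq_ne_of_mem_cycField (h2 : (2 : K) ≠ 0)
    (h4 : ¬ ∃ z : K, IsPrimitiveRoot z 4) {b : K} (hb0 : b ≠ 0) (hb : StronglyIndivisible 2 b)
    {m : ℕ} {e : AlgebraicClosure K} (he : e ∈ cycField K 2 m) :
    (e ^ 2) ^ 2 ≠ algebraMap K _ b := fun heb ↦ by
  have h2E := two_ne_zero_algebraicClosure h2
  have hi := twoPowRoot_two_sq (K := K)
  have hi2 : twoPowRoot K 2 ∈ cycField K 2 2 := twoPowRoot_mem_cycField h2 le_rfl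
  have he0 : e ≠ 0 := by
    rintro rfl
    exact hb0 ((map_eq_zero (algebraMap K (AlgebraicClosure K))).1 (by rw [← heb]; simp))
  obtain ⟨τ, hτ, hτneg⟩ := exists_algEquiv_neg (heb ▸ IntermediateField.algebraMap_mem _ b)
    (hb.notMem_cycField_two h2 h4 heb)
  obtain ⟨σ, hσ⟩ := exists_algEquiv_twoPowRoot_two h2 h4
  obtain ⟨ε, hε, hετ, hεσ⟩ : ∃ ε, ε ^ 2 = -1 ∧ τ e = ε * e ∧ σ ε = -ε := by
    have h : τ e ^ 2 = (twoPowRoot K 2 * e) ^ 2 := by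
      rw [← map_pow, hτneg, mul_pow, hi]
      ring
    rcases sq_eq_sq_iff_eq_or_eq_neg.1 h with h | h
    · exact ⟨_, hi, h, hσ⟩
    · exact ⟨-twoPowRoot K 2, by rw [neg_sq, hi], by rw [h]; ring, by rw [map_neg, hσ]⟩
  -- σ e / e is a fourth root of unity, so it lies in K_4 and τ fixes it. Hence τ σ e = ε σ e,
  -- whereas σ τ e = σ(ε e) = -ε σ e.
  have hw : τ (σ e / e) = σ e / e := by
    refine hτ _ (mem_cycField_of_pow_eq_one h2 ?_)
    have h4e : e ^ 2 ^ 2 = algebraMap K _ b := by rw [← heb]; ring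
    rw [div_pow, ← map_pow, h4e, σ.commutes, div_self]
    exact (_root_.map_ne_zero _).2 hb0
  have hσe : σ e ≠ 0 := (_root_.map_ne_zero σ).2 he0
  have hcomm := map_map_comm_of_mem_cycField h2 he σ τ
  have hτσ : τ (σ e) = σ e * ε := by
    rw [map_div₀, hετ] at hw
    have hε0 : ε ≠ 0 := by rintro rfl; simp at hε
    field_simp at hw
    linear_combination hw
  rw [hετ, map_mul, hεσ, hτσ] at hcomm
  have : 2 * (σ e * ε) = 0 := by linear_combination -hcomm
  have hε0 : ε ≠ 0 := by rintro rfl; simp at hε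
  exact mul_ne_zero h2E (mul_ne_zero hσe hε0) this

/-- An element of `K_4` times its conjugate lies in `K`. -/
theorem mul_map_mem_bot (h2 : (2 : K) ≠ 0)
    {σ : AlgebraicClosure K ≃ₐ[K] AlgebraicClosure K} (hσ : σ (twoPowRoot K 2) = -twoPowRoot K 2)
    {x : AlgebraicClosure K} (hx : x ∈ cycField K 2 2) :
    x * σ x ∈ (⊥ : IntermediateField K (AlgebraicClosure K)) := by
  rw [cycField_two_eq_adjoin h2] at hx
  obtain ⟨u, hu, v, hv, rfl⟩ := exists_add_mul_of_mem_adjoin_simple (F := ⊥)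
    (by rw [twoPowRoot_two_sq]; exact neg_mem (one_mem _)) hx
  have h : ∀ y ∈ (⊥ : IntermediateField K (AlgebraicClosure K)), σ y = y := fun y hy ↦ by
    obtain ⟨y, rfl⟩ := mem_bot.1 hy
    exact σ.commutes y
  have : (u + v * twoPowRoot K 2) * σ (u + v * twoPowRoot K 2) = u ^ 2 + v ^ 2 := by
    rw [map_add, map_mul, hσ, h u hu, h v hv]
    linear_combination -v ^ 2 * twoPowRoot_two_sq (K := K)
  rw [this]
  exact add_mem (pow_mem hu 2) (pow_mem hv 2)

/-- If `c` is a square root of a strongly indivisible element in `K_{2^n}` and `θ` is a root of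
unity of order `2^n`, then `c θ` is not a square in `K_{2^n}`. -/
theorem StronglyIndivisible.sq_ne_mul_twoPowRoot (h2 : (2 : K) ≠ 0)
    (h4 : ¬ ∃ z : K, IsPrimitiveRoot z 4) {b : K} (hb0 : b ≠ 0) (hb : StronglyIndivisible 2 b)
    {s n : ℕ} (hs : 2 ≤ s) (hsZ : cycField K 2 s = cycField K 2 2)
    (hgrow : twoPowRoot K (s + 1) ∉ cycField K 2 s) (hsn : s ≤ n)
    {c e : AlgebraicClosure K} (hcb : c ^ 2 = algebraMap K _ b)
    (hc : c ∈ cycField K 2 (n + 1)) (he : e ∈ cycField K 2 (n + 1)) :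
    e ^ 2 ≠ c * twoPowRoot K (n + 1) := fun hec ↦ by
  have h2E := two_ne_zero_algebraicClosure h2
  have hbE : algebraMap K (AlgebraicClosure K) b ≠ 0 := (_root_.map_ne_zero _).2 hb0
  have hθ0 := twoPowRoot_ne_zero (K := K) (n + 1)
  have hc0 : c ≠ 0 := by rintro rfl; exact hbE (by rw [← hcb]; ring)
  have hsq : twoPowRoot K (n + 1) ^ 2 ∈ cycField K 2 n := by
    rw [twoPowRoot_succ_sq]
    exact twoPowRoot_mem_cycField h2 le_rfl
  have hnot := twoPowRoot_succ_notMem_of_le h2 hs hsn hgrow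
  have hcs := mem_cycField_of_sq_mem_range h2 hs hgrow hb0 hcb hc
  rw [cycField_two_eq_adjoin h2] at hc he
  rcases mem_or_eq_mul_of_sq_mem h2E hsq hnot hc (hcb ▸ IntermediateField.algebraMap_mem _ b)
    with hcn | ⟨v, hv, hcv⟩
  -- With c ∈ F_n, τ fixes c and negates ζ_{n+1}, hence negates e^2.
  · obtain ⟨τ, hτ, hτneg⟩ := exists_algEquiv_neg hsq hnot
    obtain ⟨p, hp, q, hq, hpq⟩ := exists_add_mul_of_mem_adjoin_simple hsq he
    have he0 : e = 0 := by
      refine eq_zero_of_map_sq_eq_neg h2E twoPowRoot_two_sq τ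
        (hτ _ (twoPowRoot_mem_cycField h2 (by omega))) ?_ ?_
      · rw [hpq]
        simp [hτ p hp, hτ q hq, hτneg]
      · rw [hec, map_mul, hτneg, hτ c hcn, mul_neg]
    rw [he0] at hec
    exact mul_ne_zero hc0 hθ0 (by rw [← hec]; ring)
  -- If s < n, then c ∈ F_{s+1} ⊆ F_n and ζ_{n+1} = c / v would lie in F_n.
  · obtain rfl : n = s := by
      by_contra hne
      apply hnot
      have hc' : c ∈ cycField K 2 n := cycField_two_mono h2 (by omega) hcs
      have hv0 : v ≠ 0 := by rintro rfl; exact hc0 (by rw [hcv]; ring)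
      have := mul_mem (inv_mem hv) hc'
      rwa [hcv, inv_mul_cancel_left₀ hv0] at this
    rw [hsZ] at hv hsq hnot
    have hg : c * twoPowRoot K (n + 1) ∈ cycField K 2 2 := by
      rw [hcv, mul_assoc, ← sq]
      exact mul_mem hv hsq
    obtain ⟨σ, hσ⟩ := exists_algEquiv_twoPowRoot_two h2 h4
    have hσc : σ c ^ 2 = c ^ 2 := by rw [← map_pow, hcb, σ.commutes]
    -- the norm of `c θ` is `b ξ` for a root of unity `ξ`
    obtain ⟨ξ, hξ, hξ1⟩ : ∃ ξ, c * twoPowRoot K (n + 1) * σ (c * twoPowRoot K (n + 1)) =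
        algebraMap K _ b * ξ ∧ ξ ^ 2 ^ (n + 1) = 1 := by
      refine ⟨(σ c / c) * (twoPowRoot K (n + 1) * σ (twoPowRoot K (n + 1))), ?_, ?_⟩
      · rw [map_mul, ← hcb]
        field_simp
      · have h1 : (σ c / c) ^ 2 ^ (n + 1) = 1 := by
          rw [pow_succ', pow_mul, div_pow, hσc, div_self (pow_ne_zero 2 hc0), one_pow]
        rw [mul_pow, h1, mul_pow, ← map_pow, twoPowRoot_pow_eq_one]
        simp
    have hξK : ξ ∈ (⊥ : IntermediateField K (AlgebraicClosure K)) := by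
      have hN := mul_map_mem_bot h2 hσ hg
      rw [hξ] at hN
      have := mul_mem (inv_mem (IntermediateField.algebraMap_mem ⊥ b)) hN
      rwa [inv_mul_cancel_left₀ hbE] at this
    -- Let N(x) = x σ(x) be the norm from K_4 to K. Either e ∈ K_4 and N(e)^2 = b ξ, or e = (w / v)
    -- c and (N(w / v) b)^2 = b ξ; both contradict strong indivisibility.
    rcases mem_or_eq_mul_of_sq_mem h2E hsq hnot he (by rw [hec]; exact hg) with he | ⟨w, hw, hew⟩
    · refine hb.sq_ne_mul (mul_map_mem_bot h2 hσ he) hξK hξ1 ?_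
      rw [mul_pow, ← map_pow, hec, hξ]
    · have hv0 : v ≠ 0 := by rintro rfl; exact hc0 (by rw [hcv]; ring)
      have hev : e = w / v * c := by rw [hew, hcv]; field_simp
      have hwv : w / v ∈ cycField K 2 2 := div_mem hw hv
      refine hb.sq_ne_mul (mul_mem (mul_map_mem_bot h2 hσ hwv)
        (IntermediateField.algebraMap_mem _ b)) hξK hξ1 ?_
      have hσe : σ e ^ 2 = σ (w / v) ^ 2 * c ^ 2 := by rw [hev, map_mul, mul_pow, hσc]
      have he2 : e ^ 2 = (w / v) ^ 2 * c ^ 2 := by rw [hev]; ring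
      rw [← hξ, ← hec, map_pow, hσe, he2, hcb]
      ring

end StronglyIndivisible

/-! ### Reducing degrees to nonsquares -/

section KummerDegree

variable {K : Type*} [Field K]

theorem radicalField_two_pow_eq_adjoin (h2 : (2 : K) ≠ 0) {m n : ℕ} (hnm : n ≤ m) {a : K}
    (ha : a ≠ 0) {x : AlgebraicClosure K} (hx : x ^ 2 ^ n = algebraMap K _ a) :
    radicalField (cycField K 2 m) (2 ^ n) a = (cycField K 2 m)⟮x⟯ := by
  have hx0 : x ≠ 0 := by
    rintro rfl
    refine ha ((map_eq_zero (algebraMap K (AlgebraicClosure K))).1 ?_)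
    rw [← hx, zero_pow (by positivity)]
  apply le_antisymm
  · rw [radicalField, adjoin_le_iff]
    intro y hy
    have hyx : y / x ∈ cycField K 2 m := by
      refine cycField_two_mono h2 hnm (mem_cycField_of_pow_eq_one h2 (m := n) ?_)
      rw [div_pow, hx, show y ^ 2 ^ n = _ from hy, div_self]
      exact (_root_.map_ne_zero _).2 ha
    rw [← div_mul_cancel₀ y hx0]
    exact mul_mem (IntermediateField.algebraMap_mem _ (⟨_, hyx⟩ : cycField K 2 m))
      (mem_adjoin_simple_self _ x)
  · rw [adjoin_simple_le_iff]
    exact subset_adjoin _ _ hx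

/-- The workhorse for all degrees. The alternative k = 1 covers m = 1, where i is missing from F_m.
-/
theorem kummerDegree_two_eq (h2 : (2 : K) ≠ 0) {m n k : ℕ} (hnm : n ≤ m) {a : K}
    (ha : a ≠ 0) {x c : AlgebraicClosure K} (hx : x ^ 2 ^ n = algebraMap K _ a)
    (hxc : x ^ 2 ^ k = c) (hc : c ∈ cycField K 2 m)
    (h : k = 0 ∨ (k = 1 ∨ 2 ≤ m) ∧ ∀ y ∈ cycField K 2 m, y ^ 2 ≠ c) :
    kummerDegree 2 m n a = 2 ^ k := by
  rw [kummerDegree, radicalField_two_pow_eq_adjoin h2 hnm ha hx]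
  refine finrank_adjoin_simple_two_pow_root (c := (⟨c, hc⟩ : cycField K 2 m)) hxc ?_
  refine h.imp id fun ⟨hk, hns⟩ ↦ ⟨hk.imp id fun hm ↦
    ⟨⟨_, twoPowRoot_mem_cycField h2 hm⟩, Subtype.ext twoPowRoot_two_sq⟩, fun y hy ↦
    hns y y.2 (congrArg Subtype.val hy)⟩

theorem mem_cycField_of_kummerDegree_eq_one {m n : ℕ} {a : K}
    {x : AlgebraicClosure K} (hx : x ^ 2 ^ n = algebraMap K _ a)
    (h : kummerDegree 2 m n a = 1) : x ∈ cycField K 2 m := by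
  rw [kummerDegree, IntermediateField.finrank_eq_one_iff] at h
  have hmem : x ∈ radicalField (cycField K 2 m) (2 ^ n) a := subset_adjoin _ _ hx
  rw [h] at hmem
  obtain ⟨y, rfl⟩ := mem_bot.1 hmem
  exact y.2

/-- If `-1` is a `2 ^ n`-th power in `K_{2^m}`, the radical extensions of `a` and `-a` agree. -/
theorem kummerDegree_neg_of_lt (h2 : (2 : K) ≠ 0) {m n : ℕ} (hnm : n < m) {a : K} (ha : a ≠ 0) :
    kummerDegree 2 m n (-a) = kummerDegree 2 m n a := by
  obtain ⟨x, hx⟩ := IsAlgClosed.exists_pow_nat_eq (algebraMap K (AlgebraicClosure K) a)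
    (n := 2 ^ n) (by positivity)
  have hζ := twoPowRoot_mem_cycField h2 (show n + 1 ≤ m from hnm)
  have hx' : (twoPowRoot K (n + 1) * x) ^ 2 ^ n = algebraMap K _ (-a) := by
    rw [mul_pow, twoPowRoot_succ_pow, hx, map_neg]
    ring
  rw [kummerDegree, kummerDegree, radicalField_two_pow_eq_adjoin h2 hnm.le ha hx,
    radicalField_two_pow_eq_adjoin h2 hnm.le (neg_ne_zero.2 ha) hx']
  have : (cycField K 2 m)⟮twoPowRoot K (n + 1) * x⟯ = (cycField K 2 m)⟮x⟯ := by
    have hmem : ∀ F : IntermediateField (cycField K 2 m) (AlgebraicClosure K),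
        twoPowRoot K (n + 1) ∈ F := fun F ↦
      F.algebraMap_mem (⟨_, hζ⟩ : cycField K 2 m)
    apply le_antisymm <;> rw [adjoin_simple_le_iff]
    · exact mul_mem (hmem _) (mem_adjoin_simple_self _ x)
    · have := mul_mem (inv_mem (hmem _))
        (mem_adjoin_simple_self (cycField K 2 m) (twoPowRoot K (n + 1) * x))
      rwa [inv_mul_cancel_left₀ (twoPowRoot_ne_zero _)] at this
  rw [this]

end KummerDegree

/-! ### Locating square roots in the tower -/

section Tower

variable {K : Type*} [Field K]

theorem cycField_le_of_eq_cycTower (h2 : (2 : K) ≠ 0) (h : ¬ cycField K 2 2 ≠ cycTower K 2)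
    (m : ℕ) : cycField K 2 m ≤ cycField K 2 2 := by
  rw [not_ne_iff.1 h]
  exact (cycField_two_mono h2 m.le_succ).trans (cycField_le_cycTower (by omega))

theorem exists_isGreatest_cycField_eq (h2 : (2 : K) ≠ 0) (h : cycField K 2 2 ≠ cycTower K 2) :
    ∃ s : ℕ, IsGreatest {k : ℕ | cycField K 2 2 = cycField K 2 k} s := by
  obtain ⟨m, hm⟩ : ∃ m, ¬ cycField K 2 m ≤ cycField K 2 2 := by
    by_contra! hle
    exact h (le_antisymm (cycField_le_cycTower one_le_two) (iSup₂_le fun m _ ↦ hle m))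
  have hbdd : BddAbove {k : ℕ | cycField K 2 2 = cycField K 2 k} := by
    refine ⟨m, fun k hk ↦ ?_⟩
    by_contra hmk
    exact hm ((cycField_two_mono h2 (not_le.1 hmk).le).trans_eq
      (show cycField K 2 2 = cycField K 2 k from hk).symm)
  exact ⟨_, Nat.sSup_mem ⟨2, rfl⟩ hbdd, fun k hk ↦ le_csSup hbdd hk⟩

theorem isGreatest_cycField_eq_spec (h2 : (2 : K) ≠ 0) {s : ℕ}
    (h : IsGreatest {k : ℕ | cycField K 2 2 = cycField K 2 k} s) :
    2 ≤ s ∧ cycField K 2 s = cycField K 2 2 ∧ twoPowRoot K (s + 1) ∉ cycField K 2 s := by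
  have hs : 2 ≤ s := h.2 rfl
  have hsZ : cycField K 2 2 = cycField K 2 s := h.1
  refine ⟨hs, hsZ.symm, fun hmem ↦ ?_⟩
  have hle : cycField K 2 (s + 1) ≤ cycField K 2 2 := by rwa [cycField_le_iff h2, hsZ]
  have : s + 1 ≤ s := h.2 (le_antisymm (cycField_two_mono h2 (by omega)) hle)
  omega

/-- The exceptional condition of part 1 says exactly that b becomes a square in F_m. -/
theorem mem_cycField_iff_of_sq_eq (h2 : (2 : K) ≠ 0) (h4 : ¬ ∃ z : K, IsPrimitiveRoot z 4)
    {s : ℕ} (hS : cycField K 2 2 ≠ cycTower K 2 →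
      IsGreatest {k : ℕ | cycField K 2 2 = cycField K 2 k} s)
    {b : K} (hb0 : b ≠ 0) (hb : StronglyIndivisible 2 b) {c : AlgebraicClosure K}
    (hcb : c ^ 2 = algebraMap K _ b) {m : ℕ} :
    c ∈ cycField K 2 m ↔ cycField K 2 2 ≠ cycTower K 2 ∧ c ∈ cycTower K 2 ∧ s + 1 ≤ m := by
  have hc2 := hb.notMem_cycField_two h2 h4 hcb
  constructor
  · intro hc
    have hA : cycField K 2 2 ≠ cycTower K 2 := by
      by_contra hA
      exact hc2 (cycField_le_of_eq_cycTower h2 (not_not.2 hA) m hc)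
    obtain ⟨-, hsZ, -⟩ := isGreatest_cycField_eq_spec h2 (hS hA)
    refine ⟨hA, (mem_cycTower_iff h2).2 ⟨m, hc⟩, ?_⟩
    by_contra hm
    exact hc2 (hsZ ▸ cycField_two_mono h2 (show m ≤ s by omega) hc)
  · rintro ⟨hA, hc, hm⟩
    obtain ⟨hs, -, hgrow⟩ := isGreatest_cycField_eq_spec h2 (hS hA)
    obtain ⟨k, hk⟩ := (mem_cycTower_iff h2).1 hc
    exact cycField_two_mono h2 hm (mem_cycField_of_sq_mem_range h2 hs hgrow hb0 hcb hk)

/-- The tower climbs from F_1 = K to F_2, is constant up to level s, and is strict afterwards. This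
decides whether -1 is a 2^n-th power in F_n. -/
theorem twoPowRoot_succ_mem_cycField_iff (h2 : (2 : K) ≠ 0)
    (h4 : ¬ ∃ z : K, IsPrimitiveRoot z 4)
    {s : ℕ} (hS : cycField K 2 2 ≠ cycTower K 2 →
      IsGreatest {k : ℕ | cycField K 2 2 = cycField K 2 k} s) {n : ℕ} (hn : 0 < n) :
    twoPowRoot K (n + 1) ∈ cycField K 2 n ↔
      n ≠ 1 ∧ ¬ (cycField K 2 2 ≠ cycTower K 2 ∧ s ≤ n) := by
  constructor
  · refine fun h ↦ ⟨?_, fun ⟨hA, hsn⟩ ↦ ?_⟩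
    · rintro rfl
      exact twoPowRoot_two_notMem h2 h4 (cycField_one (K := K) h2 ▸ h)
    · obtain ⟨hs, -, hgrow⟩ := isGreatest_cycField_eq_spec h2 (hS hA)
      exact twoPowRoot_succ_notMem_of_le h2 hs hsn hgrow h
  · rintro ⟨hn1, hAs⟩
    refine cycField_two_mono h2 (show 2 ≤ n by omega) ?_
    rw [← cycField_le_iff h2]
    by_cases hA : cycField K 2 2 ≠ cycTower K 2
    · rw [← (isGreatest_cycField_eq_spec h2 (hS hA)).2.1]
      exact cycField_two_mono h2 (not_le.1 fun h ↦ hAs ⟨hA, h⟩)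
    · exact cycField_le_of_eq_cycTower h2 hA _

/-- For `c ^ 2 = b` with `c ∉ K_{2^n}`, the element `b ζ_{2^n}` becomes a square in `K_{2^n}`
exactly when `c` lies in the tower and `n` is the last level of the tower equal to `K_4`. -/
theorem exists_sq_eq_mul_twoPowRoot_iff (h2 : (2 : K) ≠ 0)
    (h4 : ¬ ∃ z : K, IsPrimitiveRoot z 4)
    {s : ℕ} (hS : cycField K 2 2 ≠ cycTower K 2 →
      IsGreatest {k : ℕ | cycField K 2 2 = cycField K 2 k} s)
    {b : K} (hb0 : b ≠ 0) (hb : StronglyIndivisible 2 b) {c : AlgebraicClosure K}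
    (hcb : c ^ 2 = algebraMap K _ b) {n : ℕ} (hc : c ∉ cycField K 2 n) :
    (∃ e ∈ cycField K 2 n, e ^ 2 = algebraMap K _ b * twoPowRoot K n) ↔
      cycField K 2 2 ≠ cycTower K 2 ∧ c ∈ cycTower K 2 ∧ n = s := by
  have hmem {m : ℕ} := mem_cycField_iff_of_sq_eq h2 h4 hS hb0 hb hcb (m := m)
  constructor
  · rintro ⟨e, he, heb⟩
    have hc' : c ∈ cycField K 2 (n + 1) := by
      have hζ := twoPowRoot_mem_cycField (K := K) h2 (le_refl (n + 1))
      have he' := cycField_two_mono h2 n.le_succ he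
      have hsq : e ^ 2 = (c * twoPowRoot K (n + 1)) ^ 2 := by
        rw [heb, mul_pow, twoPowRoot_succ_sq, hcb]
      have hcζ : c * twoPowRoot K (n + 1) ∈ cycField K 2 (n + 1) := by
        rcases sq_eq_sq_iff_eq_or_eq_neg.1 hsq with h | h
        · exact h ▸ he'
        · rw [← neg_neg (c * _), ← h]
          exact neg_mem he'
      have := div_mem hcζ hζ
      rwa [mul_div_cancel_right₀ _ (twoPowRoot_ne_zero _)] at this
    obtain ⟨hA, hcT, hsn⟩ := hmem.1 hc'
    refine ⟨hA, hcT, ?_⟩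
    have : ¬ s + 1 ≤ n := fun h ↦ hc (hmem.2 ⟨hA, hcT, h⟩)
    omega
  · rintro ⟨hA, hcT, rfl⟩
    obtain ⟨hs, -, hgrow⟩ := isGreatest_cycField_eq_spec h2 (hS hA)
    have hc' := hmem.2 ⟨hA, hcT, le_refl (n + 1)⟩
    have hζ := twoPowRoot_mem_cycField (K := K) h2 (le_refl n)
    rw [cycField_two_eq_adjoin h2] at hc'
    rcases mem_or_eq_mul_of_sq_mem (two_ne_zero_algebraicClosure h2)
      (by rwa [twoPowRoot_succ_sq]) hgrow hc' (hcb ▸ IntermediateField.algebraMap_mem _ b)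
      with h | ⟨v, hv, rfl⟩
    · exact (hc h).elim
    -- From c = v ζ_{n+1} one gets b = v^2 ζ_n, so b ζ_n = (v ζ_n)^2.
    · refine ⟨v * twoPowRoot K n, mul_mem hv hζ, ?_⟩
      rw [← hcb, mul_pow v (twoPowRoot K (n + 1)), twoPowRoot_succ_sq]
      ring

end Tower

/-! ### Degrees for b^(2^d) and -b^(2^d) -/

section Degrees

variable {K : Type*} [Field K]

theorem sq_ne_of_notMem {F : IntermediateField K (AlgebraicClosure K)} {c : AlgebraicClosure K}
    (hc : c ∉ F) : ∀ y ∈ F, y ^ 2 ≠ c ^ 2 := fun y hy h ↦ by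
  rcases sq_eq_sq_iff_eq_or_eq_neg.1 h with rfl | rfl
  · exact hc hy
  · exact hc (neg_neg c ▸ neg_mem hy)

theorem exists_two_pow_root (y : AlgebraicClosure K) (k : ℕ) :
    ∃ x : AlgebraicClosure K, x ^ 2 ^ k = y :=
  IsAlgClosed.exists_pow_nat_eq y (by positivity)

theorem pow_two_pow_of_le {M : Type*} [Monoid M] {x y : M} {k n : ℕ} (hx : x ^ 2 ^ k = y)
    (h : k ≤ n) : x ^ 2 ^ n = y ^ 2 ^ (n - k) := by
  rw [← hx, ← pow_mul, ← pow_add, Nat.add_sub_cancel' h]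

theorem kummerDegree_of_le (h2 : (2 : K) ≠ 0) {m n d : ℕ} (hnm : n ≤ m) {b : K} (hb0 : b ≠ 0)
    (hnd : n ≤ d) : kummerDegree 2 m n (b ^ 2 ^ d) = 1 := by
  refine kummerDegree_two_eq (k := 0) (x := algebraMap K _ (b ^ 2 ^ (d - n))) h2 hnm
    (pow_ne_zero _ hb0) ?_ rfl ?_ (.inl rfl)
  · rw [← map_pow, ← pow_mul, ← pow_add, Nat.sub_add_cancel hnd]
  · exact pow_mem (IntermediateField.algebraMap_mem _ _) _

theorem kummerDegree_of_notMem (h2 : (2 : K) ≠ 0) {m n d : ℕ} (hnm : n ≤ m) {b : K}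
    (hb0 : b ≠ 0) {c : AlgebraicClosure K} (hcb : c ^ 2 = algebraMap K _ b)
    (hc : c ∉ cycField K 2 m) : kummerDegree 2 m n (b ^ 2 ^ d) = 2 ^ (n - d) := by
  rcases le_or_gt n d with hnd | hnd
  · rw [kummerDegree_of_le h2 hnm hb0 hnd, Nat.sub_eq_zero_of_le hnd, pow_zero]
  obtain ⟨x, hx⟩ := exists_two_pow_root (algebraMap K (AlgebraicClosure K) b) (n - d)
  refine kummerDegree_two_eq h2 hnm (pow_ne_zero _ hb0) ?_ hx
    (IntermediateField.algebraMap_mem _ _) (.inr ⟨by omega, hcb ▸ sq_ne_of_notMem hc⟩)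
  rw [pow_two_pow_of_le hx (by omega), Nat.sub_sub_self hnd.le, map_pow]

theorem kummerDegree_of_mem (h2 : (2 : K) ≠ 0) (h4 : ¬ ∃ z : K, IsPrimitiveRoot z 4)
    {m n d : ℕ} (hnm : n ≤ m) {b : K} (hb0 : b ≠ 0) (hb : StronglyIndivisible 2 b)
    {c : AlgebraicClosure K} (hcb : c ^ 2 = algebraMap K _ b) (hc : c ∈ cycField K 2 m) :
    kummerDegree 2 m n (b ^ 2 ^ d) = 2 ^ (n - d - 1) := by
  rcases le_or_gt n d with hnd | hnd
  · rw [kummerDegree_of_le h2 hnm hb0 hnd, Nat.sub_eq_zero_of_le hnd, pow_zero]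
  have hm : 2 ≤ m := by
    by_contra hm
    exact hb.notMem_cycField_two h2 h4 hcb (cycField_two_mono h2 (by omega) hc)
  obtain ⟨x, hx⟩ := exists_two_pow_root c (n - d - 1)
  refine kummerDegree_two_eq h2 hnm (pow_ne_zero _ hb0) ?_ hx hc
    (.inr ⟨.inr hm, fun y hy hyc ↦ hb.sq_sq_ne_of_mem_cycField h2 h4 hb0 hy (by rw [hyc, hcb])⟩)
  rw [pow_two_pow_of_le hx (by omega), show n - (n - d - 1) = d + 1 by omega, pow_succ', pow_mul,
    hcb, map_pow]

theorem kummerDegree_neg_of_eq_one_of_mem (h2 : (2 : K) ≠ 0) {n : ℕ} {a : K} (ha : a ≠ 0)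
    (h : kummerDegree 2 n n a = 1) (hζ : twoPowRoot K (n + 1) ∈ cycField K 2 n) :
    kummerDegree 2 n n (-a) = 1 := by
  obtain ⟨x, hx⟩ := exists_two_pow_root (algebraMap K (AlgebraicClosure K) a) n
  refine kummerDegree_two_eq (k := 0) (x := twoPowRoot K (n + 1) * x) h2 le_rfl
    (neg_ne_zero.2 ha) ?_ (pow_one _) (mul_mem hζ (mem_cycField_of_kummerDegree_eq_one hx h))
    (.inl rfl)
  rw [mul_pow, twoPowRoot_succ_pow, hx, map_neg, neg_one_mul]

theorem kummerDegree_neg_of_eq_one_of_notMem (h2 : (2 : K) ≠ 0) {n : ℕ} {a : K} (ha : a ≠ 0)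
    (h : kummerDegree 2 n n a = 1) (hζ : twoPowRoot K (n + 1) ∉ cycField K 2 n) :
    kummerDegree 2 n n (-a) = 2 := by
  obtain ⟨x, hx⟩ := exists_two_pow_root (algebraMap K (AlgebraicClosure K) a) n
  have hxn := mem_cycField_of_kummerDegree_eq_one hx h
  have hx0 : x ≠ 0 := by
    rintro rfl
    refine ha ((map_eq_zero (algebraMap K (AlgebraicClosure K))).1 ?_)
    rw [← hx, zero_pow (by positivity)]
  refine kummerDegree_two_eq (k := 1) (x := twoPowRoot K (n + 1) * x) h2 le_rfl
    (neg_ne_zero.2 ha) ?_ (by rw [pow_one]) ?_ (.inr ⟨.inl rfl, sq_ne_of_notMem fun hmem ↦ hζ ?_⟩)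
  · rw [mul_pow, twoPowRoot_succ_pow, hx, map_neg, neg_one_mul]
  · rw [mul_pow, twoPowRoot_succ_sq]
    exact mul_mem (twoPowRoot_mem_cycField h2 le_rfl) (pow_mem hxn 2)
  · have := div_mem hmem hxn
    rwa [mul_div_cancel_right₀ _ hx0] at this

/-- Because d + 2 ≤ n, b ζ_{d+1} = (c ζ_{d+2})^2 with ζ_{d+2} ∈ F_n, so it is a square in F_n only
if c ∈ F_n. -/
theorem kummerDegree_neg_of_notMem (h2 : (2 : K) ≠ 0) {n d : ℕ} {b : K} (hb0 : b ≠ 0)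
    (hdn : d + 2 ≤ n) {c : AlgebraicClosure K} (hcb : c ^ 2 = algebraMap K _ b)
    (hc : c ∉ cycField K 2 n) : kummerDegree 2 n n (-b ^ 2 ^ d) = 2 ^ (n - d) := by
  have hθ := twoPowRoot_mem_cycField (K := K) h2 hdn
  obtain ⟨x, hx⟩ := exists_two_pow_root (algebraMap K _ b * twoPowRoot K (d + 1)) (n - d)
  refine kummerDegree_two_eq h2 le_rfl (neg_ne_zero.2 (pow_ne_zero _ hb0)) ?_ hx
    (mul_mem (IntermediateField.algebraMap_mem _ _) (twoPowRoot_mem_cycField h2 (by omega)))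
    (.inr ⟨.inr (by omega), ?_⟩)
  · rw [pow_two_pow_of_le hx (by omega), Nat.sub_sub_self (by omega), mul_pow,
      twoPowRoot_succ_pow, map_neg, map_pow, mul_neg_one]
  · rw [← hcb, ← twoPowRoot_succ_sq, ← mul_pow]
    refine sq_ne_of_notMem fun hmem ↦ hc ?_
    have := div_mem hmem hθ
    rwa [mul_div_cancel_right₀ _ (twoPowRoot_ne_zero _)] at this

theorem kummerDegree_neg_of_mem (h2 : (2 : K) ≠ 0) (h4 : ¬ ∃ z : K, IsPrimitiveRoot z 4)
    {n d : ℕ} {b : K} (hb0 : b ≠ 0) (hb : StronglyIndivisible 2 b)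
    {s : ℕ} (hs : 2 ≤ s) (hsZ : cycField K 2 s = cycField K 2 2)
    (hgrow : twoPowRoot K (s + 1) ∉ cycField K 2 s) (hsn : s + 1 ≤ n)
    (hdn : d + 2 ≤ n) {c : AlgebraicClosure K} (hcb : c ^ 2 = algebraMap K _ b)
    (hc : c ∈ cycField K 2 n) : kummerDegree 2 n n (-b ^ 2 ^ d) = 2 ^ (n - d - 1) := by
  have hθ := twoPowRoot_mem_cycField (K := K) h2 hdn
  obtain ⟨x, hx⟩ := exists_two_pow_root (c * twoPowRoot K (d + 2)) (n - d - 1)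
  refine kummerDegree_two_eq h2 le_rfl (neg_ne_zero.2 (pow_ne_zero _ hb0)) ?_ hx
    (mul_mem hc hθ) (.inr ⟨.inr (by omega), fun e he hec ↦ ?_⟩)
  · rw [pow_two_pow_of_le hx (by omega), show n - (n - d - 1) = d + 1 by omega, mul_pow,
      twoPowRoot_succ_pow, pow_succ', pow_mul, hcb, map_neg, map_pow, mul_neg_one]
  -- If d + 2 < n, then ζ_{d+2} is itself a square in F_n and can be divided out, leaving a fourth
  -- root of b. The boundary n = d + 2 needs the norm argument.
  · rcases hdn.eq_or_lt with rfl | hlt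
    · exact hb.sq_ne_mul_twoPowRoot h2 h4 hb0 hs hsZ hgrow (n := d + 1) (by omega) hcb hc he hec
    · refine hb.sq_sq_ne_of_mem_cycField h2 h4 hb0
        (div_mem he (twoPowRoot_mem_cycField h2 (show d + 3 ≤ n from hlt))) ?_
      rw [div_pow, hec, twoPowRoot_succ_sq, mul_div_cancel_right₀ _ (twoPowRoot_ne_zero _), hcb]

/-- In the boundary case n = d + 1, ζ_{d+2} need not lie in F_n, so b ζ_{d+1} may become a square
although b is not one. -/
theorem kummerDegree_succ_neg (h2 : (2 : K) ≠ 0) {d : ℕ} {b : K} (hb0 : b ≠ 0) :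
    ((∃ e ∈ cycField K 2 (d + 1), e ^ 2 = algebraMap K _ b * twoPowRoot K (d + 1)) →
      kummerDegree 2 (d + 1) (d + 1) (-b ^ 2 ^ d) = 1) ∧
    ((¬ ∃ e ∈ cycField K 2 (d + 1), e ^ 2 = algebraMap K _ b * twoPowRoot K (d + 1)) →
      kummerDegree 2 (d + 1) (d + 1) (-b ^ 2 ^ d) = 2) := by
  have ha : -b ^ 2 ^ d ≠ 0 := neg_ne_zero.2 (pow_ne_zero _ hb0)
  have hroot : ∀ x : AlgebraicClosure K, x ^ 2 = algebraMap K _ b * twoPowRoot K (d + 1) →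
      x ^ 2 ^ (d + 1) = algebraMap K _ (-b ^ 2 ^ d) := fun x hx ↦ by
    rw [pow_succ', pow_mul, hx, mul_pow, twoPowRoot_succ_pow, map_neg, map_pow, mul_neg_one]
  constructor
  · rintro ⟨e, he, heb⟩
    exact kummerDegree_two_eq (k := 0) h2 le_rfl ha (hroot e heb) (pow_one e) he (.inl rfl)
  · intro hne
    obtain ⟨x, hx⟩ := IsAlgClosed.exists_pow_nat_eq
      (algebraMap K _ b * twoPowRoot K (d + 1)) two_pos
    exact kummerDegree_two_eq (k := 1) h2 le_rfl ha (hroot x hx) hx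
      (mul_mem (IntermediateField.algebraMap_mem _ _) (twoPowRoot_mem_cycField h2 le_rfl))
      (.inr ⟨.inl rfl, fun y hy hyb ↦ hne ⟨y, hy, hyb⟩⟩)

theorem finrank_sqrtField_sq (b : K) : Module.finrank K (sqrtField (b ^ 2)) = 1 := by
  rw [IntermediateField.finrank_eq_one_iff, eq_bot_iff,
    sqrtField_le_iff (map_pow (algebraMap K _) b 2).symm]
  exact IntermediateField.algebraMap_mem _ b

theorem finrank_sqrtField_neg_sq (h2 : (2 : K) ≠ 0) (h4 : ¬ ∃ z : K, IsPrimitiveRoot z 4)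
    {b : K} (hb0 : b ≠ 0) : Module.finrank K (sqrtField (-b ^ 2)) = 2 := by
  have hx : (twoPowRoot K 2 * algebraMap K _ b) ^ 2 = algebraMap K _ (-b ^ 2) := by
    rw [mul_pow, twoPowRoot_two_sq, map_neg, map_pow, neg_one_mul]
  have h : sqrtField (-b ^ 2) = K⟮twoPowRoot K 2 * algebraMap K _ b⟯ := by
    apply le_antisymm
    · rw [sqrtField_le_iff hx]
      exact mem_adjoin_simple_self K _
    · rw [adjoin_simple_le_iff]
      exact subset_adjoin _ _ hx
  rw [h]
  refine finrank_adjoin_simple_two_pow_root (k := 1) hx (.inr ⟨.inl rfl, fun y hy ↦ ?_⟩)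
  refine sq_ne_of_notMem (F := ⊥) (fun hmem ↦ twoPowRoot_two_notMem h2 h4 ?_) _
    (IntermediateField.algebraMap_mem _ y) (by rw [hx, ← map_pow, hy])
  have := div_mem hmem (IntermediateField.algebraMap_mem _ b)
  rwa [mul_div_cancel_right₀ _ ((_root_.map_ne_zero _).2 hb0)] at this

end Degrees

/-! ### Assembling the cases -/

theorem theorem13 {K : Type*} [Field K] (h2 : (2 : K) ≠ 0)
    (h4 : ¬ ∃ z : K, IsPrimitiveRoot z 4) :
    -- if `K_4 ≠ K_{2^∞}`, the greatest `s` with `K_4 = K_{2^s}` exists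
    (cycField K 2 2 ≠ cycTower K 2 →
      ∃ s : ℕ, IsGreatest {k : ℕ | cycField K 2 2 = cycField K 2 k} s) ∧
    ∀ s : ℕ,
      (cycField K 2 2 ≠ cycTower K 2 →
        IsGreatest {k : ℕ | cycField K 2 2 = cycField K 2 k} s) →
    ∀ a : K, a ≠ 0 → ∀ m n : ℕ, 0 < n → n ≤ m →
      -- part 1 (subtraction of natural numbers is truncated: `n - d` is `max(0, n - d)`)
      (∀ (b : K) (d : ℕ), b ≠ 0 → StronglyIndivisible 2 b → a = b ^ 2 ^ d →
        (¬ (cycField K 2 2 ≠ cycTower K 2 ∧ sqrtField b ≤ cycTower K 2 ∧ s + 1 ≤ m) →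
          kummerDegree 2 m n a = 2 ^ (n - d)) ∧
        (cycField K 2 2 ≠ cycTower K 2 ∧ sqrtField b ≤ cycTower K 2 ∧ s + 1 ≤ m →
          kummerDegree 2 m n a = 2 ^ (n - d - 1))) ∧
      -- part 2
      (∀ (b : K) (d : ℕ), 0 < d → b ≠ 0 → StronglyIndivisible 2 b → a = -b ^ 2 ^ d →
        (¬ (m = 1 ∧ n = 1) →
          ¬ (cycField K 2 2 ≠ cycTower K 2 ∧ m = n ∧ s ≤ n ∧ kummerDegree 2 m n (-a) = 1) →
          ¬ (cycField K 2 2 ≠ cycTower K 2 ∧ sqrtField b ≤ cycTower K 2 ∧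
              m = n ∧ n = s ∧ s = d + 1 ∧ kummerDegree 2 m n (-a) = 2) →
          kummerDegree 2 m n a = kummerDegree 2 m n (-a)) ∧
        (m = 1 ∧ n = 1 →
          Module.finrank K (sqrtField (-a)) = 1 ∧ Module.finrank K (sqrtField a) = 2 ∧
          kummerDegree 2 m n (-a) = 1 ∧ kummerDegree 2 m n a = 2) ∧
        (cycField K 2 2 ≠ cycTower K 2 ∧ m = n ∧ s ≤ n ∧ kummerDegree 2 m n (-a) = 1 →
          kummerDegree 2 m n a = 2) ∧
        (cycField K 2 2 ≠ cycTower K 2 ∧ sqrtField b ≤ cycTower K 2 ∧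
            m = n ∧ n = s ∧ s = d + 1 ∧ kummerDegree 2 m n (-a) = 2 →
          kummerDegree 2 m n a = 1)) := by
  have hT := fun s h ↦ isGreatest_cycField_eq_spec h2 (s := s) h
  refine ⟨exists_isGreatest_cycField_eq h2, fun s hS a ha m n hn hnm ↦ ⟨?_, ?_⟩⟩
  · rintro b d hb0 hb rfl
    obtain ⟨c, hcb⟩ := IsAlgClosed.exists_pow_nat_eq (algebraMap K (AlgebraicClosure K) b) two_pos
    rw [sqrtField_le_iff hcb, ← mem_cycField_iff_of_sq_eq h2 h4 hS hb0 hb hcb]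
    exact ⟨fun hc ↦ kummerDegree_of_notMem h2 hnm hb0 hcb hc,
      fun hc ↦ kummerDegree_of_mem h2 h4 hnm hb0 hb hcb hc⟩
  · rintro b d hd hb0 hb rfl
    obtain ⟨c, hcb⟩ := IsAlgClosed.exists_pow_nat_eq (algebraMap K (AlgebraicClosure K) b) two_pos
    rw [sqrtField_le_iff hcb, neg_neg]
    have hbd : b ^ 2 ^ d ≠ 0 := pow_ne_zero _ hb0
    rcases hnm.lt_or_eq with hlt | rfl
    · exact ⟨fun _ _ _ ↦ kummerDegree_neg_of_lt h2 hlt hbd, fun h ↦ by omega,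
        fun h ↦ by omega, fun h ↦ by omega⟩
    have hcb' := mem_cycField_iff_of_sq_eq h2 h4 hS hb0 hb hcb (m := n)
    by_cases h1 : kummerDegree 2 n n (b ^ 2 ^ d) = 1
    · have hζ := twoPowRoot_succ_mem_cycField_iff h2 h4 hS hn
      by_cases hmem : twoPowRoot K (n + 1) ∈ cycField K 2 n
      · have ha1 := kummerDegree_neg_of_eq_one_of_mem h2 hbd h1 hmem
        rw [hζ] at hmem
        exact ⟨fun _ _ _ ↦ ha1.trans h1.symm, fun h ↦ (hmem.1 h.1).elim,
          fun h ↦ (hmem.2 ⟨h.1, h.2.2.1⟩).elim, fun _ ↦ ha1⟩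
      · have ha2 := kummerDegree_neg_of_eq_one_of_notMem h2 hbd h1 hmem
        rw [hζ] at hmem
        refine ⟨fun hn1 hs1 _ ↦ ?_, fun h ↦ ?_, fun _ ↦ ha2, fun h ↦ by omega⟩
        · exact (hmem ⟨fun h ↦ hn1 ⟨h, h⟩, fun h ↦ hs1 ⟨h.1, rfl, h.2, h1⟩⟩).elim
        -- Since d > 0, b^(2^d) is a square in K, so its negative has square roots outside K, as i ∉
        -- K.
        · obtain ⟨d, rfl⟩ : ∃ k, d = k + 1 := ⟨d - 1, by omega⟩
          rw [pow_succ, pow_mul]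
          rw [pow_succ, pow_mul] at h1 ha2
          exact ⟨finrank_sqrtField_sq _, finrank_sqrtField_neg_sq h2 h4 (pow_ne_zero _ hb0), h1, ha2⟩
    · have hdn : d < n := by
        by_contra hdn
        exact h1 (kummerDegree_of_le h2 le_rfl hb0 (by omega))
      by_cases hc : c ∈ cycField K 2 n
      · have hdeg := kummerDegree_of_mem h2 h4 le_rfl hb0 hb hcb hc (d := d)
        -- For n = d + 1 the degree 2^(n-d-1) would be 1, which is excluded here.
        have hdn2 : d + 2 ≤ n := by
          by_contra hdn2
          exact h1 (by rw [hdeg, show n - d - 1 = 0 by omega, pow_zero])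
        have hA := hcb'.1 hc
        obtain ⟨hs, hsZ, hgrow⟩ := hT s (hS hA.1)
        have hdeg' := kummerDegree_neg_of_mem h2 h4 hb0 hb hs hsZ hgrow hA.2.2 hdn2 hcb hc
        exact ⟨fun _ _ _ ↦ hdeg'.trans hdeg.symm, fun h ↦ by omega,
          fun h ↦ (h1 h.2.2.2).elim, fun h ↦ by omega⟩
      · have hdeg := kummerDegree_of_notMem h2 le_rfl hb0 hcb hc (d := d) (n := n)
        by_cases hdn2 : d + 2 ≤ n
        · have hdeg' := kummerDegree_neg_of_notMem h2 hb0 hdn2 hcb hc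
          exact ⟨fun _ _ _ ↦ hdeg'.trans hdeg.symm, fun h ↦ by omega,
            fun h ↦ (h1 h.2.2.2).elim, fun h ↦ by omega⟩
        obtain rfl : n = d + 1 := by omega
        have hdeg2 : kummerDegree 2 (d + 1) (d + 1) (b ^ 2 ^ d) = 2 := by
          rw [hdeg, show d + 1 - d = 1 by omega, pow_one]
        have hiff := exists_sq_eq_mul_twoPowRoot_iff h2 h4 hS hb0 hb hcb hc
        have hdeg' := kummerDegree_succ_neg h2 hb0 (d := d)
        by_cases hsq : ∃ e ∈ cycField K 2 (d + 1), e ^ 2 = algebraMap K _ b * twoPowRoot K (d + 1)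
        · have hA := hiff.1 hsq
          exact ⟨fun _ _ h ↦ (h ⟨hA.1, hA.2.1, rfl, hA.2.2, hA.2.2.symm, hdeg2⟩).elim,
            fun h ↦ by omega, fun h ↦ (h1 h.2.2.2).elim, fun _ ↦ hdeg'.1 hsq⟩
        · exact ⟨fun _ _ _ ↦ (hdeg'.2 hsq).trans hdeg2.symm, fun h ↦ by omega,
            fun h ↦ (h1 h.2.2.2).elim,
            fun h ↦ (hsq (hiff.2 ⟨h.1, h.2.1, h.2.2.2.1⟩)).elim⟩
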